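/- Let $\mathbb{F}_q$ be a finite field with $q$ elements, $K_\infty=\mathbb{F}_q((1/\theta))$ with the absolute value normalized by $|\theta|=q$, and $\mathbb{C}_\infty$ the completion of an algebraic closure of $K_\infty$. Let $\mathbb{T}=\{\sum_{k\ge0}c_kt^k\in\mathbb{C}_\infty[[t]] : |c_k|\to 0\}$ be the Tate algebra. Let $\phi$ be a Drinfeld $\mathbb{F}_q[x]$-module over $\mathbb{C}_\infty$ of rank $r\ge1$, given by $\phi_x=\theta+g_1\tau+\cdots+g_r\tau^r$ with $g_i\in\mathbb{C}_\infty$, $g_r\ne0$, where $\tau$ is the $q$-power Frobenius. Let $\exp_\phi(\mu)=\sum_{n\ge0}e_n\mu^{q^n}$ be its exponential, i.e. the everywhere convergent $\mathbb{F}_q$-linear power series with $e_0=1$ and $\phi_a(\exp_\phi(\mu))=\exp_\phi(a(\theta)\mu)$ for all $a\in\mathbb{F}_q[x]$. For $z\in\mathbb{C}_\infty$ let $$\omega_z(t)=\sum_{k=0}^\infty \exp_\phi\Big(\frac{z}{\theta^{k+1}}\Big)t^k$$ be the Anderson generating function. For $l\ge0$ let $\delta_l^t$ be the $l$-th Hasse--Schmidt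 derivative, $\delta^t_l\big(\sum_k c_kt^k\big)=\sum_{k\ge l}\binom{k}{l}c_kt^{k-l}$. Let $\mathfrak{p}=\sum_{j=0}^d a_jt^j\in\mathbb{F}_q[t]$ be a monic irreducible polynomial of degree $d$, let $$\operatorname{O}^{(2)}_{\mathfrak{p}}(x,t)=\sum_{k=0}^{d-1}\Big(\sum_{j=0}^{d-k-1}a_{k+j+1}x^j\Big)t^k\in\mathbb{F}_q[x,t]$$ be the rank-two Weil operator, and for $l\ge0$ let $E^{(l)}_0(x),\dots,E^{(l)}_{d-1}(x)\in\mathbb{F}_q[x]$ be the polynomials determined by $$\sum_{i=0}^{d-1}E_i^{(l)}(x)\,t^i\equiv \operatorname{O}_{\mathfrak{p}}^{(2)}(x,t)^{l+1}\pmod{\mathfrak{p}(t)}.$$ Then for every $z\in\mathbb{C}_\infty$ (in particular for every $z$ in the lattice $\ker\exp_\phi$) and every $l\ge0$, one has $\omega_z\in\mathbb{T}$, $\delta_l^t\omega_z\in\mathbb{T}$, and $$\delta_l^t\,\omega_z\equiv\sum_{i=0}^{d-1}\exp_\phi\Big(\frac{E_i^{(l)}(\theta)\,z}{\mathfrak{p}(\theta)^{l+1}}\Big)t^i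 \pmod{\mathfrak{p}(t)\,\mathbb{T}}.$$ -/

import Mathlib

noncomputable section

namespace WeilAGF

open Polynomial WithZero
open scoped NNReal

section Fields

variable (F : Type*) [Field F] [Fintype F]

/-- The completion `K_∞ = 𝔽_q((1/θ))` of `𝔽_q(θ)` at the infinite place: Laurent series in the
variable `1/θ`. -/
abbrev KInf : Type _ := LaurentSeries F

/-- The element `θ` of `K_∞`, i.e. the inverse of the Laurent variable. -/
def thetaK : KInf F := HahnSeries.single (-1) 1

lemma one_lt_card : (1 : ℝ≥0) < (Fintype.card F : ℝ≥0) := by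
  exact_mod_cast Fintype.one_lt_card (α := F)

/-- The absolute value on `K_∞` is normalised by `|θ| = q`. -/
instance rankOneKInf : (Valued.v : Valuation (KInf F) ℤᵐ⁰).RankOne where
  hom' := (WithZeroMulInt.toNNReal (ne_of_gt (lt_trans one_pos (one_lt_card F)))).comp
    MonoidWithZeroHom.ValueGroup₀.embedding
  strictMono' := (WithZeroMulInt.toNNReal_strictMono (one_lt_card F)).comp
    MonoidWithZeroHom.ValueGroup₀.embedding_strictMono
  exists_val_nontrivial := by
    refine ⟨thetaK F, ?_⟩
    rw [thetaK, LaurentSeries.valuation_single_zpow]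
    refine ⟨by simp, ?_⟩
    rw [← WithZero.exp_zero, Ne, WithZero.exp_inj]
    decide

instance normedFieldKInf : NontriviallyNormedField (KInf F) :=
  Valued.toNontriviallyNormedField (KInf F) ℤᵐ⁰

instance ultrametricKInf : IsUltrametricDist (KInf F) :=
  ⟨fun x y z ↦ by
    refine (Valuation.norm_add_le _ (x - y) (y - z)).trans_eq' ?_
    simp only [sub_add_sub_cancel]
    rfl⟩

lemma norm_thetaK : ‖thetaK F‖ = Fintype.card F := by
  have : ‖thetaK F‖ = ((WithZeroMulInt.toNNReal (ne_of_gt (lt_trans one_pos (one_lt_card F)))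
      (Valued.v (thetaK F)) : ℝ≥0) : ℝ) := by
    change ((WithZeroMulInt.toNNReal
      (ne_of_gt (lt_trans one_pos (one_lt_card F))) (MonoidWithZeroHom.ValueGroup₀.embedding
      (Valued.v.restrict (thetaK F))) : ℝ≥0) : ℝ) = _
    rw [Valuation.embedding_restrict]
  rw [this, thetaK, LaurentSeries.valuation_single_zpow]
  rw [WithZeroMulInt.toNNReal_neg_apply _ (by simp)]
  simp [WithZero.exp]

/-- An algebraic closure of `K_∞`, with the unique extension of the absolute value. -/
abbrev KInfBar : Type _ := AlgebraicClosure (KInf F)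

instance normedFieldKInfBar : NormedField (KInfBar F) :=
  spectralNorm.normedField (KInf F) (KInfBar F)

instance normedAlgebraKInfBar : NormedAlgebra (KInf F) (KInfBar F) :=
  spectralNorm.normedAlgebra (KInf F) (KInfBar F)

instance ultrametricKInfBar : IsUltrametricDist (KInfBar F) :=
  IsUltrametricDist.isUltrametricDist_of_forall_norm_add_le_max_norm
    (isNonarchimedean_spectralNorm (K := KInf F) (L := KInfBar F))

/-- `ℂ_∞`, the completion of an algebraic closure of `K_∞`. -/
def CInf : Type _ := UniformSpace.Completion (KInfBar F)

instance normedFieldCInf : NormedField (CInf F) :=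
  inferInstanceAs (NormedField (UniformSpace.Completion (KInfBar F)))

instance completeSpaceCInf : CompleteSpace (CInf F) :=
  inferInstanceAs (CompleteSpace (UniformSpace.Completion (KInfBar F)))

/-- The embedding of `K_∞` into `ℂ_∞`. -/
def ofKInf : KInf F →+* CInf F :=
  (UniformSpace.Completion.coeRingHom : KInfBar F →+* UniformSpace.Completion (KInfBar F)).comp
    (algebraMap (KInf F) (KInfBar F))

/-- `ℂ_∞` as an algebra over the constant field `𝔽_q`. -/
instance algebraCInf : Algebra F (CInf F) :=
  ((ofKInf F).comp (algebraMap F (KInf F))).toAlgebra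

/-- The element `θ` of `ℂ_∞`. -/
def theta : CInf F := ofKInf F (thetaK F)

lemma norm_ofKInf (a : KInf F) : ‖ofKInf F a‖ = ‖a‖ := by
  change ‖((algebraMap (KInf F) (KInfBar F) a : KInfBar F) :
    UniformSpace.Completion (KInfBar F))‖ = ‖a‖
  rw [UniformSpace.Completion.norm_coe, norm_algebraMap']

lemma norm_theta : ‖theta F‖ = Fintype.card F := by
  rw [theta, norm_ofKInf, norm_thetaK]

instance ultrametricCInf : IsUltrametricDist (CInf F) :=
  (IsUltrametricDist.of_normedAlgebra (KInf F) :
    IsUltrametricDist (UniformSpace.Completion (KInfBar F)))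

end Fields

/-! ### Drinfeld modules and the exponential -/

section Drinfeld

variable (F : Type*) [Field F] [Fintype F]

/-- The `q`-power Frobenius `τ` of `ℂ_∞`, as an `𝔽_q`-linear map. -/
def tau : Module.End F (CInf F) :=
  (FiniteField.frobeniusAlgHom F (CInf F)).toLinearMap

lemma tau_pow_apply (i : ℕ) (x : CInf F) : (tau F ^ i) x = x ^ Fintype.card F ^ i := by
  induction i with
  | zero => simp
  | succ n ih =>
    rw [pow_succ', Module.End.mul_apply, ih, tau, pow_succ, pow_mul]
    simp

/-- A Drinfeld module `φ : 𝔽_q[x] → ℂ_∞{τ}` of rank `r ≥ 1`, given by the coefficients of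
`φ_x = θ + g₁ τ + ⋯ + g_r τ ^ r` with `g_r ≠ 0` (since `𝔽_q[x]` is free on `x`, the `𝔽_q`-algebra
homomorphism `φ` is determined by `φ_x`). -/
structure DrinfeldModule (r : ℕ) where
  one_le_rank : 1 ≤ r
  g : ℕ → CInf F
  g_zero : g 0 = theta F
  g_rank : g r ≠ 0
  g_of_lt : ∀ i, r < i → g i = 0

variable {F} {r : ℕ} (φ : DrinfeldModule F r)

namespace DrinfeldModule

/-- The operator `φ_x = θ + g₁ τ + ⋯ + g_r τ ^ r` on `ℂ_∞`. -/
def opX : Module.End F (CInf F) :=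
  ∑ i ∈ Finset.range (r + 1), LinearMap.mulLeft F (φ.g i) * tau F ^ i

/-- The Drinfeld action: `φ_a`, for `a ∈ 𝔽_q[x]`, as an operator on `ℂ_∞`. -/
def op : F[X] →ₐ[F] Module.End F (CInf F) := aeval φ.opX

lemma opX_apply (μ : CInf F) :
    φ.opX μ = ∑ i ∈ Finset.range (r + 1), φ.g i * μ ^ Fintype.card F ^ i := by
  simp [opX, LinearMap.sum_apply, tau_pow_apply]

/-- The coefficients `1 / D_n` of `exp_φ`: they are determined by `1 / D_0 = 1` and by comparing
the coefficients of `μ ^ (q ^ n)` in `φ_x (exp_φ μ) = exp_φ (θ μ)`. -/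
def expCoeff : ℕ → CInf F
  | 0 => 1
  | n + 1 => (∑ i : Fin (n + 1), φ.g (n + 1 - i) * expCoeff i ^ Fintype.card F ^ (n + 1 - i)) /
      (theta F ^ Fintype.card F ^ (n + 1) - theta F)
decreasing_by exact i.2

/-- The exponential function `exp_φ (μ) = ∑ μ ^ (q ^ n) / D_n` of `φ`. -/
def exp (μ : CInf F) : CInf F := ∑' n, φ.expCoeff n * μ ^ Fintype.card F ^ n

lemma theta_pow_sub_ne (n : ℕ) : theta F ^ Fintype.card F ^ (n + 1) - theta F ≠ 0 ∧
    ‖theta F ^ Fintype.card F ^ (n + 1) - theta F‖ = (Fintype.card F : ℝ) ^ Fintype.card F ^ (n + 1)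
    := by
  have hq : 1 < Fintype.card F := Fintype.one_lt_card
  have hq' : (1 : ℝ) < Fintype.card F := by exact_mod_cast hq
  have hlt : ‖theta F‖ < ‖theta F ^ Fintype.card F ^ (n + 1)‖ := by
    rw [norm_pow, norm_theta]
    exact lt_self_pow₀ hq' (Nat.one_lt_pow (by omega) hq)
  have h : ‖theta F ^ Fintype.card F ^ (n + 1) - theta F‖ =
      (Fintype.card F : ℝ) ^ Fintype.card F ^ (n + 1) := by
    rw [sub_eq_add_neg, IsUltrametricDist.norm_add_eq_max_of_norm_ne_norm, norm_neg,
      max_eq_left hlt.le, norm_pow, norm_theta]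
    rw [norm_neg]; exact hlt.ne'
  refine ⟨fun h0 => ?_, h⟩
  rw [h0, norm_zero] at h
  have : (0 : ℝ) < (Fintype.card F : ℝ) ^ Fintype.card F ^ (n + 1) := by positivity
  linarith

/-- The recursion satisfied by the coefficients, in symmetric form. -/
lemma expCoeff_rec (n : ℕ) :
    ∑ i ∈ Finset.range (n + 1), φ.g (n - i) * φ.expCoeff i ^ Fintype.card F ^ (n - i) =
      φ.expCoeff n * theta F ^ Fintype.card F ^ n := by
  cases n with
  | zero => simp [expCoeff, φ.g_zero]
  | succ n =>
    rw [Finset.sum_range_succ]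
    have h := (theta_pow_sub_ne (F := F) n).1
    have e : φ.expCoeff (n + 1) * (theta F ^ Fintype.card F ^ (n + 1) - theta F) =
        ∑ i ∈ Finset.range (n + 1),
          φ.g (n + 1 - i) * φ.expCoeff i ^ Fintype.card F ^ (n + 1 - i) := by
      conv_lhs => rw [expCoeff]
      rw [div_mul_cancel₀ _ h, Finset.sum_range]
    rw [← e]
    simp [φ.g_zero]
    ring

lemma exists_bound : ∃ K ρ : ℝ, 0 < K ∧ 0 < ρ ∧ ρ < 1 ∧
    ∀ n, ‖φ.expCoeff n‖ ≤ (K * ρ ^ n) ^ Fintype.card F ^ n := by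
  have hq : 2 ≤ Fintype.card F := Fintype.one_lt_card
  have hq' : (2 : ℝ) ≤ Fintype.card F := by exact_mod_cast hq
  have hr : (1 : ℝ) ≤ r := by exact_mod_cast φ.one_le_rank
  set q := Fintype.card F with hqd
  set ρ : ℝ := 1 - 1 / (4 * r) with hρ
  have hx : 1 / (4 * (r : ℝ)) ≤ 1 / 4 := by
    apply one_div_le_one_div_of_le <;> linarith
  have hx0 : 0 < 1 / (4 * (r : ℝ)) := by positivity
  have hρ0 : 0 < ρ := by linarith
  have hρ1 : ρ < 1 := by linarith
  have hρr : 3 / 4 ≤ ρ ^ r := by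
    have := one_add_mul_le_pow (a := -(1 / (4 * (r : ℝ)))) (by linarith) r
    have e : (r : ℝ) * -(1 / (4 * (r : ℝ))) = - (1 / 4) := by field_simp
    rw [e] at this
    rw [hρ, sub_eq_add_neg]
    linarith
  obtain ⟨G, hG⟩ : ∃ G : ℝ, ∀ j, ‖φ.g j‖ ≤ G := by
    refine ⟨∑ j ∈ Finset.range (r + 1), ‖φ.g j‖, fun j => ?_⟩
    by_cases hj : j ≤ r
    · exact Finset.single_le_sum (f := fun j => ‖φ.g j‖) (fun _ _ => norm_nonneg _)
        (Finset.mem_range.2 (by omega))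
    · rw [φ.g_of_lt j (by omega), norm_zero]
      exact Finset.sum_nonneg fun _ _ => norm_nonneg _
  obtain ⟨N, hN⟩ := pow_unbounded_of_one_lt G (show (1 : ℝ) < 3 / 2 by norm_num)
  set K : ℝ := 1 + ∑ i ∈ Finset.range (N + 1), (‖φ.expCoeff i‖ + 1) / ρ ^ i with hK
  have hK0 : 0 < K := by
    have : 0 ≤ ∑ i ∈ Finset.range (N + 1), (‖φ.expCoeff i‖ + 1) / ρ ^ i :=
      Finset.sum_nonneg fun _ _ => by positivity
    linarith
  refine ⟨K, ρ, hK0, hρ0, hρ1, fun n => ?_⟩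
  induction n using Nat.strong_induction_on with
  | _ n ih =>
  by_cases hn : n ≤ N
  · have h1 : (‖φ.expCoeff n‖ + 1) / ρ ^ n ≤ K := by
      have := Finset.single_le_sum (s := Finset.range (N + 1))
        (f := fun i => (‖φ.expCoeff i‖ + 1) / ρ ^ i) (fun _ _ => by positivity)
        (Finset.mem_range.2 (show n < N + 1 by omega))
      linarith
    rw [div_le_iff₀ (by positivity)] at h1
    have h2 : 1 ≤ K * ρ ^ n := by linarith [norm_nonneg (φ.expCoeff n)]
    calc ‖φ.expCoeff n‖ ≤ K * ρ ^ n := by linarith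
      _ ≤ _ := le_self_pow₀ h2 (by positivity)
  · obtain ⟨m, rfl⟩ : ∃ m, n = m + 1 := ⟨n - 1, by omega⟩
    have hθ := theta_pow_sub_ne (F := F) m
    rw [expCoeff, norm_div, hθ.2, div_le_iff₀ (by positivity)]
    apply IsUltrametricDist.norm_sum_le_of_forall_le_of_nonneg (by positivity)
    intro i _
    have hi := i.2
    rw [norm_mul, norm_pow]
    by_cases hj : r < m + 1 - i
    · rw [φ.g_of_lt _ hj, norm_zero, zero_mul]; positivity
    have hG' : ‖φ.g (m + 1 - i)‖ ≤ (q * ρ ^ (m + 1 - (i : ℕ))) ^ q ^ (m + 1) := by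
      have a1 : (3 : ℝ) / 2 ≤ q * ρ ^ (m + 1 - (i : ℕ)) := by
        have : ρ ^ r ≤ ρ ^ (m + 1 - (i : ℕ)) :=
          pow_le_pow_of_le_one hρ0.le hρ1.le (by omega)
        nlinarith
      have a2 : N ≤ q ^ (m + 1) := by
        have := Nat.lt_pow_self (n := m + 1) (a := q) (by omega)
        omega
      calc ‖φ.g (m + 1 - i)‖ ≤ G := hG _
        _ ≤ (3 / 2) ^ N := hN.le
        _ ≤ (3 / 2) ^ q ^ (m + 1) := pow_le_pow_right₀ (by norm_num) a2
        _ ≤ _ := pow_le_pow_left₀ (by norm_num) a1 _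
    have hc : ‖φ.expCoeff i‖ ^ q ^ (m + 1 - (i : ℕ)) ≤ (K * ρ ^ (i : ℕ)) ^ q ^ (m + 1) := by
      calc _ ≤ ((K * ρ ^ (i : ℕ)) ^ q ^ (i : ℕ)) ^ q ^ (m + 1 - (i : ℕ)) :=
            pow_le_pow_left₀ (norm_nonneg _) (ih i hi) _
        _ = _ := by
            rw [← pow_mul, ← pow_add]
            congr 2
            omega
    calc _ ≤ (q * ρ ^ (m + 1 - (i : ℕ))) ^ q ^ (m + 1) * (K * ρ ^ (i : ℕ)) ^ q ^ (m + 1) :=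
          mul_le_mul hG' hc (by positivity) (by positivity)
      _ = (K * (ρ ^ (m + 1 - (i : ℕ)) * ρ ^ (i : ℕ))) ^ q ^ (m + 1) * q ^ q ^ (m + 1) := by
          rw [← mul_pow, ← mul_pow]; ring
      _ = _ := by rw [← pow_add, Nat.sub_add_cancel (by omega)]

/-- The exponential series converges everywhere. -/
theorem summable_exp (μ : CInf F) :
    Summable fun n => φ.expCoeff n * μ ^ Fintype.card F ^ n := by
  obtain ⟨K, ρ, hK, hρ0, hρ1, hb⟩ := φ.exists_bound
  have hg : Summable fun n : ℕ => K * ‖μ‖ * ρ ^ n :=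
    (summable_geometric_of_lt_one hρ0.le hρ1).mul_left _
  refine Summable.of_norm_bounded_eventually_nat hg ?_
  have hev : ∀ᶠ n : ℕ in Filter.atTop, K * ‖μ‖ * ρ ^ n < 1 :=
    hg.tendsto_atTop_zero.eventually (gt_mem_nhds one_pos)
  filter_upwards [hev] with n hn
  have h0 : 0 ≤ K * ‖μ‖ * ρ ^ n := by positivity
  calc ‖φ.expCoeff n * μ ^ Fintype.card F ^ n‖
      ≤ (K * ρ ^ n) ^ Fintype.card F ^ n * ‖μ‖ ^ Fintype.card F ^ n := by
        rw [norm_mul, norm_pow]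
        exact mul_le_mul_of_nonneg_right (hb n) (by positivity)
    _ = (K * ‖μ‖ * ρ ^ n) ^ Fintype.card F ^ n := by rw [← mul_pow]; ring
    _ ≤ K * ‖μ‖ * ρ ^ n :=
        pow_le_of_le_one h0 hn.le (pow_ne_zero _ Fintype.card_ne_zero)

theorem hasSum_exp (μ : CInf F) :
    HasSum (fun n => φ.expCoeff n * μ ^ Fintype.card F ^ n) (φ.exp μ) :=
  (φ.summable_exp μ).hasSum

/-- The functional equation `φ_x (exp_φ μ) = exp_φ (θ μ)`. -/
theorem opX_exp (μ : CInf F) : φ.opX (φ.exp μ) = φ.exp (theta F * μ) := by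
  have h1 : ∀ j, HasSum (fun n => if j ≤ n then
      φ.g j * φ.expCoeff (n - j) ^ Fintype.card F ^ j * μ ^ Fintype.card F ^ n else 0)
      (φ.g j * φ.exp μ ^ Fintype.card F ^ j) := by
    intro j
    have hinj : Function.Injective fun i : ℕ => i + j := add_left_injective j
    rw [← hinj.hasSum_iff]
    · have h := (φ.hasSum_exp μ).map ((tau F) ^ j).toAddMonoidHom (by
        change Continuous fun x => ((tau F) ^ j) x
        simp only [tau_pow_apply]
        fun_prop)
      have h' := h.mul_left (φ.g j)
      change HasSum (fun i => φ.g j * ((tau F) ^ j) (φ.expCoeff i * μ ^ Fintype.card F ^ i))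
        (φ.g j * ((tau F) ^ j) (φ.exp μ)) at h'
      simp only [tau_pow_apply] at h'
      convert h' using 2 with i
      simp only [Function.comp, le_add_iff_nonneg_left, zero_le, if_true, Nat.add_sub_cancel]
      rw [mul_pow, ← pow_mul, ← pow_add, mul_assoc]
    · intro n hn
      rw [if_neg]
      intro hjn
      exact hn ⟨n - j, Nat.sub_add_cancel hjn⟩
  have h2 := hasSum_sum (s := Finset.range (r + 1)) fun j _ => h1 j
  rw [← opX_apply] at h2
  refine h2.unique ?_
  convert φ.hasSum_exp (theta F * μ) using 2 with n
  rw [mul_pow, ← mul_assoc, ← expCoeff_rec, Finset.sum_mul]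
  have e1 : ∑ i ∈ Finset.range (n + 1),
      φ.g (n - i) * φ.expCoeff i ^ Fintype.card F ^ (n - i) * μ ^ Fintype.card F ^ n =
      ∑ j ∈ Finset.range (n + 1), if j ≤ n then
        φ.g j * φ.expCoeff (n - j) ^ Fintype.card F ^ j * μ ^ Fintype.card F ^ n else 0 := by
    rw [← Finset.sum_range_reflect]
    refine Finset.sum_congr rfl fun j hj => ?_
    have hj' : j ≤ n := by have := Finset.mem_range.1 hj; omega
    rw [if_pos hj', show n + 1 - 1 - j = n - j by omega, show n - (n - j) = j by omega]
  rw [e1, Finset.sum_subset (Finset.range_mono (show n + 1 ≤ n + r + 1 by omega)),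
    Finset.sum_subset (Finset.range_mono (show r + 1 ≤ n + r + 1 by omega))]
  · intro j _ hj
    have hj' : r < j := by
      by_contra h
      exact hj (Finset.mem_range.2 (by omega))
    simp [φ.g_of_lt j hj']
  · intro j _ hj
    rw [if_neg]
    intro h
    exact hj (Finset.mem_range.2 (by omega))

/-- `exp_φ` is `𝔽_q`-linear. -/
def expLin : Module.End F (CInf F) where
  toFun := φ.exp
  map_add' x y := by
    refine (φ.hasSum_exp (x + y)).unique ?_
    convert (φ.hasSum_exp x).add (φ.hasSum_exp y) using 2 with n
    simp only [← tau_pow_apply, map_add, mul_add]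
  map_smul' c x := by
    refine (φ.hasSum_exp (c • x)).unique ?_
    rw [RingHom.id_apply]
    have e : (fun n => φ.expCoeff n * (c • x) ^ Fintype.card F ^ n) =
        fun n => algebraMap F (CInf F) c * (φ.expCoeff n * x ^ Fintype.card F ^ n) := by
      funext n
      rw [← tau_pow_apply, ← tau_pow_apply, map_smul, Algebra.smul_def]
      ring
    rw [e, Algebra.smul_def]
    exact (φ.hasSum_exp x).mul_left (algebraMap F (CInf F) c)

/-- The functional equation `φ_a (exp_φ μ) = exp_φ (a(θ) μ)` for all `a ∈ 𝔽_q[x]`. -/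
theorem op_exp (a : F[X]) (μ : CInf F) : φ.op a (φ.exp μ) = φ.exp (aeval (theta F) a * μ) := by
  induction a using Polynomial.induction_on generalizing μ with
  | C c =>
    have h : φ.exp (algebraMap F (CInf F) c * μ) = c • φ.exp μ := by
      rw [← Algebra.smul_def]
      exact φ.expLin.map_smul c μ
    rw [aeval_C, h, op, aeval_C]
    rfl
  | add p q hp hq =>
    have h : ∀ x y, φ.exp (x + y) = φ.exp x + φ.exp y := φ.expLin.map_add
    rw [map_add, LinearMap.add_apply, hp, hq, map_add, add_mul, h]
  | monomial n c ih =>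
    rw [pow_succ, ← mul_assoc, map_mul, Module.End.mul_apply]
    have hX : φ.op X (φ.exp μ) = φ.exp (theta F * μ) := by
      rw [← φ.opX_exp, op, aeval_X]
    rw [hX, ih, map_mul (aeval (theta F)) (C c * X ^ n) X, aeval_X, mul_assoc]

/-- The Anderson generating function `ω_z(t) = ∑ exp_φ (z / θ ^ (k + 1)) t ^ k`. -/
def agf (z : CInf F) : PowerSeries (CInf F) :=
  PowerSeries.mk fun k => φ.exp (z / theta F ^ (k + 1))

end DrinfeldModule

end Drinfeld

/-! ### The Tate algebra -/

section Tate

variable (F : Type*) [Field F] [Fintype F]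

/-- The Tate algebra `𝕋`: power series over `ℂ_∞` whose coefficients tend to zero. -/
def tateAlgebra : Subring (PowerSeries (CInf F)) := PowerSeries.IsRestricted.subring 1

lemma mem_tateAlgebra (f : PowerSeries (CInf F)) : f ∈ tateAlgebra F ↔
    Filter.Tendsto (fun k => PowerSeries.coeff k f) Filter.atTop (nhds 0) := by
  change PowerSeries.IsRestricted 1 f ↔ _
  rw [PowerSeries.isRestricted_iff']
  simp [← tendsto_zero_iff_norm_tendsto_zero]

variable {F}

/-- A polynomial over `𝔽_q` in the variable `t`, seen as a power series over `ℂ_∞`. -/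
def toSeries (f : F[X]) : PowerSeries (CInf F) :=
  ((f.map (algebraMap F (CInf F)) : (CInf F)[X]) : PowerSeries (CInf F))

/-- Congruence modulo `f(t)` in the Tate algebra: `ω₁, ω₂ ∈ 𝕋` and `ω₁ - ω₂ ∈ f 𝕋`. -/
def TateModEq (f : F[X]) (ω₁ ω₂ : PowerSeries (CInf F)) : Prop :=
  ω₁ ∈ tateAlgebra F ∧ ω₂ ∈ tateAlgebra F ∧ ∃ h ∈ tateAlgebra F, ω₁ - ω₂ = toSeries f * h

/-- The `l`-th Hasse-Schmidt derivative with respect to `t`: the coefficient of `X ^ l` in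
`ω(t + X)`, i.e. `∑ c_k t ^ k ↦ ∑ (k choose l) c_k t ^ (k - l)`. -/
def hasseSchmidt {R : Type*} [Semiring R] (l : ℕ) (ω : PowerSeries R) : PowerSeries R :=
  PowerSeries.mk fun k => ((k + l).choose l : R) * PowerSeries.coeff (k + l) ω

lemma hasseSchmidt_coe {R : Type*} [Semiring R] (l : ℕ) (f : R[X]) :
    hasseSchmidt l (f : PowerSeries R) = (Polynomial.hasseDeriv l f : R[X]) := by
  ext k
  simp [hasseSchmidt, Polynomial.hasseDeriv_coeff]

end Tate

/-! ### The rank-two Weil operator -/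

section Weil

variable {F : Type*} [Field F]

/-- The dual map on monomials: `D_f (x ^ i) = ∑_{j = 0}^{n - i - 1} a_{i + j + 1} x ^ j`, where
`f = ∑ a_j x ^ j` has degree `n`. -/
def dualMap (f : F[X]) (i : ℕ) : F[X] :=
  ∑ j ∈ Finset.range (f.natDegree - i), C (f.coeff (i + j + 1)) * X ^ j

/-- The rank-two Weil operator `O_f(x, t) = ∑_{k < n} D_f (x ^ k) t ^ k`, as a polynomial in `t`
(outer variable) over `𝔽_q[x]`. -/
def weilOp (f : F[X]) : F[X][X] :=
  ∑ k ∈ Finset.range f.natDegree, C (dualMap f k) * X ^ k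

lemma coeff_dualMap (f : F[X]) (i j : ℕ) : (dualMap f i).coeff j = f.coeff (i + j + 1) := by
  simp only [dualMap, finsetSum_coeff, coeff_C_mul_X_pow]
  rw [Finset.sum_ite_eq]
  split_ifs with h
  · rfl
  · rw [Finset.mem_range] at h
    exact (coeff_eq_zero_of_natDegree_lt (by omega)).symm

lemma coeff_weilOp (f : F[X]) (k : ℕ) : (weilOp f).coeff k = dualMap f k := by
  simp only [weilOp, finsetSum_coeff, coeff_C_mul_X_pow]
  rw [Finset.sum_ite_eq]
  split_ifs with h
  · rfl
  · rw [Finset.mem_range] at h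
    rw [dualMap, show f.natDegree - k = 0 by omega, Finset.sum_range_zero]

/-- The identity `(x - t) O_f(x, t) = f(x) - f(t)`. -/
lemma weilOp_spec (f : F[X]) : (C X - X) * weilOp f = C f - f.map C := by
  ext k j
  simp only [sub_mul, coeff_sub, coeff_C_mul, coeff_map]
  cases k <;> cases j <;>
    simp [coeff_X_mul, coeff_weilOp, coeff_dualMap, coeff_C, add_comm, add_left_comm]

/-- `E_i^{(l)}(x)`: the coefficient of `t ^ i` in the remainder of `O_p(x, t) ^ (l + 1)` upon
division by the monic polynomial `p(t)`. -/
def remCoeff (p : F[X]) (l i : ℕ) : F[X] :=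
  ((weilOp p ^ (l + 1)) %ₘ (p.map C)).coeff i

end Weil

end WeilAGF

end

noncomputable section

namespace WeilAGF

open Polynomial

/-! ### Absolute values of constants and of polynomial values at `θ`. -/

section Theta

variable (F : Type*) [Field F] [Fintype F]

/-! Apply `exp_φ` to a power series in `t` coefficient by coefficient (`expSeries`). Since `exp_φ`
is `𝔽_q`-linear and tends to `0` at `0`, this operation is `𝔽_q[t]`-linear
(`expSeries_toSeries_mul`) and preserves the Tate algebra (`expSeries_mem_tateAlgebra`). It
therefore carries congruences modulo `p(t)` to congruences modulo `p(t)`.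

The series `δ_l ω_z` is the image of `z / (θ - t)^(l+1)` (`hasseSchmidt_agf`), so the theorem
reduces to a statement about rational functions. From `(θ - t) O_p(θ, t) = p(θ) - p(t)` one gets
`O_p(θ, t)^(l+1) = (p(θ) - p(t))^(l+1) / (θ - t)^(l+1)`, which is `p(θ)^(l+1) / (θ - t)^(l+1)`
modulo `p(t)` (`exists_thetaSubInv_pow_sub`). As `|θ| > 1`, the series `1 / (θ - t)` lies in `𝕋`, so
all cofactors do too. Multiplying by `z / p(θ)^(l+1)` and applying `exp_φ` gives the claim. -/

lemma norm_algebraMap_le_one (c : F) : ‖algebraMap F (CInf F) c‖ ≤ 1 := by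
  have h : algebraMap F (CInf F) c ^ Fintype.card F = algebraMap F (CInf F) c := by
    rw [← map_pow, FiniteField.pow_card]
  by_contra hlt
  have h2 := lt_self_pow₀ (not_le.1 hlt) (Fintype.one_lt_card (α := F))
  rw [← norm_pow, h] at h2
  exact lt_irrefl _ h2

lemma one_lt_norm_theta : 1 < ‖theta F‖ := by
  rw [norm_theta]
  exact_mod_cast Fintype.one_lt_card (α := F)

lemma theta_ne_zero : theta F ≠ 0 :=
  norm_pos_iff.1 (one_pos.trans (one_lt_norm_theta F))

variable {F}

/-- Constants have norm at most `1` and `|θ| > 1`, so the leading term strictly dominates all the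
others and cannot be cancelled by them. -/
lemma aeval_theta_ne_zero {p : F[X]} (hp : p.Monic) : aeval (theta F) p ≠ 0 := by
  intro h0
  have h1 := one_lt_norm_theta F
  rw [aeval_eq_sum_range, Finset.sum_range_succ, hp.coeff_natDegree, one_smul,
    add_eq_zero_iff_neg_eq] at h0
  have h2 : ‖theta F ^ p.natDegree‖ < ‖theta F‖ ^ p.natDegree := by
    rw [← h0, norm_neg]
    -- In degree `0` the sum is empty and the exponent `p.natDegree - 1` used below would truncate.
    rcases Nat.eq_zero_or_pos p.natDegree with hd | hd
    · simp [hd]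
    refine (IsUltrametricDist.norm_sum_le_of_forall_le_of_nonneg
      (C := ‖theta F‖ ^ (p.natDegree - 1)) (by positivity) fun i hi => ?_).trans_lt
      (pow_lt_pow_right₀ h1 (by omega))
    rw [Algebra.smul_def, norm_mul, norm_pow]
    calc _ ≤ 1 * ‖theta F‖ ^ i := by
          gcongr
          exact norm_algebraMap_le_one F _
      _ ≤ _ := by
          rw [one_mul]
          exact pow_le_pow_right₀ h1.le (by have := Finset.mem_range.1 hi; omega)
  rw [norm_pow] at h2
  exact lt_irrefl _ h2

end Theta

/-! ### The series `1 / (θ - t)` and its powers. -/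

section Tate

variable {F : Type*} [Field F] [Fintype F]

lemma coe_mem_tateAlgebra (f : (CInf F)[X]) : (f : PowerSeries (CInf F)) ∈ tateAlgebra F := by
  rw [mem_tateAlgebra]
  refine tendsto_const_nhds.congr' ?_
  filter_upwards [Filter.eventually_gt_atTop f.natDegree] with k hk
  rw [Polynomial.coeff_coe, coeff_eq_zero_of_natDegree_lt hk]

variable (F) in
/-- The inverse of `θ - t` as a power series in `t`. -/
def thetaSubInv : PowerSeries (CInf F) := PowerSeries.mk fun k => (theta F)⁻¹ ^ (k + 1)

lemma thetaSubInv_mem_tateAlgebra : thetaSubInv F ∈ tateAlgebra F := by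
  rw [mem_tateAlgebra]
  simp only [thetaSubInv, PowerSeries.coeff_mk]
  refine (tendsto_pow_atTop_nhds_zero_of_norm_lt_one ?_).comp (Filter.tendsto_add_atTop_nat 1)
  rw [norm_inv]
  exact inv_lt_one_of_one_lt₀ (one_lt_norm_theta F)

lemma thetaSubInv_mul :
    thetaSubInv F * (PowerSeries.C (theta F) - PowerSeries.X) = 1 := by
  have h := theta_ne_zero F
  ext k
  cases k with
  | zero => simp [mul_sub, thetaSubInv, h]
  | succ k =>
    rw [mul_sub, map_sub, PowerSeries.coeff_mul_C, PowerSeries.coeff_succ_mul_X]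
    simp [thetaSubInv, PowerSeries.coeff_one, pow_succ _ (k + 1), mul_right_comm _ _ (theta F), h]

lemma thetaSubInv_eq :
    thetaSubInv F =
      PowerSeries.C (theta F)⁻¹ * PowerSeries.rescale (theta F)⁻¹ (PowerSeries.mk 1) := by
  ext k
  simp [thetaSubInv, pow_succ']

/-- This is the binomial expansion of `(1 - u)^(-(l+1))` at `u = t / θ`. The binomial coefficients
are those of the Hasse–Schmidt derivative. -/
lemma coeff_thetaSubInv_pow (l k : ℕ) :
    PowerSeries.coeff k (thetaSubInv F ^ (l + 1)) =
      ((k + l).choose l : CInf F) * (theta F)⁻¹ ^ (k + l + 1) := by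
  rw [thetaSubInv_eq, mul_pow, ← map_pow, ← map_pow, PowerSeries.mk_one_pow_eq_mk_choose_add,
    PowerSeries.coeff_C_mul, PowerSeries.coeff_rescale, PowerSeries.coeff_mk, add_comm l k]
  ring

end Tate

/-! ### The exponential applied coefficientwise to series in `t`. -/

namespace DrinfeldModule

variable {F : Type*} [Field F] [Fintype F] {r : ℕ} (φ : DrinfeldModule F r)

/-- The `n`-th term is at most `(K ρ^n ‖μ‖)^(q^n)`. When `K ‖μ‖ ≤ 1` the outer power only decreases
this, so every term is at most `K ‖μ‖`, and the ultrametric inequality passes the bound to the sum.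
-/
lemma exists_norm_exp_le : ∃ K : ℝ, 0 < K ∧ ∀ μ, K * ‖μ‖ ≤ 1 → ‖φ.exp μ‖ ≤ K * ‖μ‖ := by
  obtain ⟨K, ρ, hK, hρ0, hρ1, hb⟩ := φ.exists_bound
  refine ⟨K, hK, fun μ hμ => ?_⟩
  refine IsUltrametricDist.norm_tsum_le_of_forall_le_of_nonneg (by positivity) fun n => ?_
  have h1 : K * ρ ^ n * ‖μ‖ ≤ K * ‖μ‖ := by
    have := pow_le_one₀ hρ0.le hρ1.le (n := n)
    gcongr
    exact mul_le_of_le_one_right hK.le this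
  calc ‖φ.expCoeff n * μ ^ Fintype.card F ^ n‖
      ≤ (K * ρ ^ n) ^ Fintype.card F ^ n * ‖μ‖ ^ Fintype.card F ^ n := by
        rw [norm_mul, norm_pow]
        exact mul_le_mul_of_nonneg_right (hb n) (by positivity)
    _ = (K * ρ ^ n * ‖μ‖) ^ Fintype.card F ^ n := by rw [← mul_pow]
    _ ≤ K * ρ ^ n * ‖μ‖ :=
        pow_le_of_le_one (by positivity) (h1.trans hμ) (pow_ne_zero _ Fintype.card_ne_zero)
    _ ≤ _ := h1

lemma exp_zero : φ.exp 0 = 0 := φ.expLin.map_zero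

lemma tendsto_exp_zero : Filter.Tendsto φ.exp (nhds 0) (nhds 0) := by
  obtain ⟨K, hK, h⟩ := φ.exists_norm_exp_le
  have hlim : Filter.Tendsto (fun μ : CInf F => K * ‖μ‖) (nhds 0) (nhds 0) := by
    have : Continuous fun μ : CInf F => K * ‖μ‖ := by fun_prop
    simpa using this.tendsto 0
  refine squeeze_zero_norm' ?_ hlim
  filter_upwards [hlim.eventually (gt_mem_nhds one_pos)] with μ hμ
  exact h μ hμ.le

lemma exp_algebraMap_mul (c : F) (x : CInf F) :
    φ.exp (algebraMap F (CInf F) c * x) = algebraMap F (CInf F) c * φ.exp x := by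
  rw [← Algebra.smul_def, ← Algebra.smul_def]
  exact φ.expLin.map_smul c x

/-- `exp_φ` applied to the coefficients of a power series in `t`. -/
def expSeries (G : PowerSeries (CInf F)) : PowerSeries (CInf F) :=
  PowerSeries.mk fun k => φ.exp (PowerSeries.coeff k G)

lemma expSeries_mem_tateAlgebra {G : PowerSeries (CInf F)} (hG : G ∈ tateAlgebra F) :
    φ.expSeries G ∈ tateAlgebra F := by
  rw [mem_tateAlgebra] at hG ⊢
  simp only [expSeries, PowerSeries.coeff_mk]
  exact φ.tendsto_exp_zero.comp hG

lemma expSeries_sub (G H : PowerSeries (CInf F)) :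
    φ.expSeries (G - H) = φ.expSeries G - φ.expSeries H := by
  ext k
  simp only [expSeries, PowerSeries.coeff_mk, map_sub]
  exact φ.expLin.map_sub _ _

/-- Each coefficient of the product is a finite sum weighted by coefficients of `f`, which lie in
`𝔽_q` and so commute with `exp_φ`. -/
lemma expSeries_toSeries_mul (f : F[X]) (G : PowerSeries (CInf F)) :
    φ.expSeries (toSeries f * G) = toSeries f * φ.expSeries G := by
  have hsum (s : Finset (ℕ × ℕ)) (g : ℕ × ℕ → CInf F) :
      φ.exp (∑ i ∈ s, g i) = ∑ i ∈ s, φ.exp (g i) := map_sum φ.expLin g s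
  ext k
  simp only [expSeries, PowerSeries.coeff_mk, PowerSeries.coeff_mul, toSeries,
    Polynomial.coeff_coe, coeff_map, hsum, exp_algebraMap_mul]

lemma hasseSchmidt_agf (l : ℕ) (z : CInf F) :
    hasseSchmidt l (φ.agf z) = φ.expSeries (PowerSeries.C z * thetaSubInv F ^ (l + 1)) := by
  ext k
  simp only [hasseSchmidt, agf, expSeries, PowerSeries.coeff_mk, PowerSeries.coeff_C_mul,
    coeff_thetaSubInv_pow]
  -- The binomial coefficient is the image of an element of `𝔽_q`, so it moves inside `exp_φ`.
  rw [← map_natCast (algebraMap F (CInf F)), ← exp_algebraMap_mul, map_natCast, inv_pow]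
  congr 1
  ring

lemma agf_mem_tateAlgebra (z : CInf F) : φ.agf z ∈ tateAlgebra F := by
  have h : φ.agf z = hasseSchmidt 0 (φ.agf z) := by
    ext k
    simp [hasseSchmidt]
  rw [h, hasseSchmidt_agf]
  have hz := coe_mem_tateAlgebra (C z)
  rw [Polynomial.coe_C] at hz
  exact φ.expSeries_mem_tateAlgebra (mul_mem hz (pow_mem thetaSubInv_mem_tateAlgebra _))

end DrinfeldModule

/-! ### The Weil operator at `x = θ`, modulo `p(t)`. -/

section Weil

variable {F : Type*} [Field F]

lemma remCoeff_eq_zero {p : F[X]} (hp : p.Monic) (l : ℕ) {i : ℕ} (hi : p.natDegree ≤ i) :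
    remCoeff p l i = 0 := by
  refine coeff_eq_zero_of_degree_lt ((degree_modByMonic_lt _ (hp.map C)).trans_le ?_)
  exact degree_map_le.trans (degree_le_of_natDegree_le hi)

variable [Fintype F]

variable (F) in
/-- Specialisation `x = θ` of polynomials in `x` and `t`. -/
def specialize : F[X][X] →+* (CInf F)[X] := mapRingHom (aeval (theta F) : F[X] →ₐ[F] CInf F)

lemma specialize_map_C (p : F[X]) : specialize F (p.map C) = p.map (algebraMap F (CInf F)) := by
  ext k
  simp [specialize]

lemma specialize_C (p : F[X]) : specialize F (C p) = C (aeval (theta F) p) := by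
  simp [specialize]

lemma specialize_weilOp (p : F[X]) :
    (C (theta F) - X) * specialize F (weilOp p) =
      C (aeval (theta F) p) - p.map (algebraMap F (CInf F)) := by
  have h := congrArg (specialize F) (weilOp_spec p)
  rw [map_mul, map_sub, map_sub, specialize_map_C, specialize_C, specialize_C, aeval_X] at h
  simpa [specialize] using h

/-- Division with remainder takes place over `𝔽_q[x]` and is then specialised. The cofactor `V` is a
polynomial in `t`, hence lies in `𝕋`. -/
lemma specialize_weilOp_pow_modByMonic (p : F[X]) (l : ℕ) : ∃ V : (CInf F)[X],
    specialize F (weilOp p ^ (l + 1) %ₘ p.map C) =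
      specialize F (weilOp p) ^ (l + 1) - p.map (algebraMap F (CInf F)) * V := by
  refine ⟨specialize F (weilOp p ^ (l + 1) /ₘ p.map C), ?_⟩
  have h := congrArg (specialize F) (modByMonic_add_div (weilOp p ^ (l + 1)) (p.map C))
  rw [map_add, map_mul, map_pow, specialize_map_C] at h
  rw [← h, add_sub_cancel_right]

lemma coe_specialize_weilOp (p : F[X]) :
    (specialize F (weilOp p) : PowerSeries (CInf F)) =
      thetaSubInv F * ((C (aeval (theta F) p) - p.map (algebraMap F (CInf F)) : (CInf F)[X]) :
        PowerSeries (CInf F)) := by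
  rw [← specialize_weilOp, Polynomial.coe_mul, Polynomial.coe_sub, Polynomial.coe_C,
    Polynomial.coe_X, ← mul_assoc, thetaSubInv_mul, one_mul]

/-- Modulo `p(t)`, the series `p(θ)^(l+1) / (θ - t)^(l+1)` is the remainder of the power of the
Weil operator. -/
lemma exists_thetaSubInv_pow_sub (p : F[X]) (l : ℕ) : ∃ H ∈ tateAlgebra F,
    PowerSeries.C (aeval (theta F) p ^ (l + 1)) * thetaSubInv F ^ (l + 1) -
      (specialize F (weilOp p ^ (l + 1) %ₘ p.map C) : PowerSeries (CInf F)) =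
      toSeries p * H := by
  obtain ⟨Q, hQ⟩ := specialize_weilOp_pow_modByMonic p l
  set a := aeval (theta F) p
  set P : (CInf F)[X] := p.map (algebraMap F (CInf F)) with hP
  -- With `a = p(θ)` and `P = p(t)`, the difference `a^(l+1) - (a - P)^(l+1)` is divisible by `a -
  -- (a - P) = P`.
  obtain ⟨V, hV⟩ := sub_dvd_pow_sub_pow (C a) (C a - P) (l + 1)
  rw [sub_sub_cancel] at hV
  refine ⟨thetaSubInv F ^ (l + 1) * V + Q, add_mem (mul_mem
    (pow_mem thetaSubInv_mem_tateAlgebra _) (coe_mem_tateAlgebra _)) (coe_mem_tateAlgebra _), ?_⟩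
  have hV' := congrArg (fun f : (CInf F)[X] => (f : PowerSeries (CInf F))) hV
  simp only [Polynomial.coe_mul, Polynomial.coe_sub, Polynomial.coe_pow, Polynomial.coe_C] at hV'
  rw [hQ, toSeries, ← hP, Polynomial.coe_sub, Polynomial.coe_pow, coe_specialize_weilOp,
    Polynomial.coe_mul, Polynomial.coe_sub, Polynomial.coe_C, map_pow,
    mul_pow]
  linear_combination thetaSubInv F ^ (l + 1) * hV'

lemma coeff_specialize_weilOp_pow_modByMonic (p : F[X]) (l k : ℕ) :
    (specialize F (weilOp p ^ (l + 1) %ₘ p.map C)).coeff k =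
      aeval (theta F) (remCoeff p l k) := by
  simp [specialize, remCoeff]

lemma DrinfeldModule.expSeries_modByMonic {r : ℕ} (φ : DrinfeldModule F r) {p : F[X]}
    (hp : p.Monic) (l : ℕ) (z : CInf F) :
    φ.expSeries (PowerSeries.C (z / aeval (theta F) p ^ (l + 1)) *
      (specialize F (weilOp p ^ (l + 1) %ₘ p.map C) : PowerSeries (CInf F))) =
    ∑ i ∈ Finset.range p.natDegree,
      PowerSeries.C (φ.exp (aeval (theta F) (remCoeff p l i) * z /
        aeval (theta F) p ^ (l + 1))) * PowerSeries.X ^ i := by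
  ext k
  simp only [expSeries, PowerSeries.coeff_mk, PowerSeries.coeff_C_mul, Polynomial.coeff_coe,
    coeff_specialize_weilOp_pow_modByMonic, map_sum, PowerSeries.coeff_X_pow, mul_ite, mul_one,
    mul_zero, Finset.sum_ite_eq, Finset.mem_range]
  split_ifs with h
  · congr 1
    ring
  -- The remainder has degree below `p.natDegree`, and `exp_φ 0 = 0` removes the higher
  -- coefficients.
  · rw [remCoeff_eq_zero hp l (not_lt.1 h), map_zero, mul_zero, exp_zero]

end Weil

end WeilAGF

end

theorem mainTheorem5 {F : Type*} [Field F] [Fintype F] {r : ℕ} (φ : WeilAGF.DrinfeldModule F r)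
    (p : Polynomial F) (hp : p.Monic) (hirr : Irreducible p) (l : ℕ) (z : WeilAGF.CInf F) :
    φ.agf z ∈ WeilAGF.tateAlgebra F ∧
    WeilAGF.TateModEq p (WeilAGF.hasseSchmidt l (φ.agf z))
      (∑ i ∈ Finset.range p.natDegree,
        PowerSeries.C (φ.exp (Polynomial.aeval (WeilAGF.theta F) (WeilAGF.remCoeff p l i) * z /
          Polynomial.aeval (WeilAGF.theta F) p ^ (l + 1))) * PowerSeries.X ^ i) := by
  have ha := WeilAGF.aeval_theta_ne_zero hp
  have hC (c : WeilAGF.CInf F) : PowerSeries.C c ∈ WeilAGF.tateAlgebra F := by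
    have h := WeilAGF.coe_mem_tateAlgebra (Polynomial.C c)
    rwa [Polynomial.coe_C] at h
  refine ⟨φ.agf_mem_tateAlgebra z, ?_⟩
  rw [φ.hasseSchmidt_agf, ← φ.expSeries_modByMonic hp]
  refine ⟨φ.expSeries_mem_tateAlgebra (mul_mem (hC z)
    (pow_mem WeilAGF.thetaSubInv_mem_tateAlgebra _)), φ.expSeries_mem_tateAlgebra
    (mul_mem (hC _) (WeilAGF.coe_mem_tateAlgebra _)), ?_⟩
  obtain ⟨H, hH, h⟩ := WeilAGF.exists_thetaSubInv_pow_sub p l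
  set a := Polynomial.aeval (WeilAGF.theta F) p
  -- The cofactor is the exponential of the one found before exponentiating, rescaled by `z /
  -- p(θ)^(l+1)`.
  refine ⟨φ.expSeries (PowerSeries.C (z / a ^ (l + 1)) * H),
    φ.expSeries_mem_tateAlgebra (mul_mem (hC _) hH), ?_⟩
  rw [← φ.expSeries_toSeries_mul, ← φ.expSeries_sub]
  congr 1
  have hz : PowerSeries.C z = PowerSeries.C (z / a ^ (l + 1)) * PowerSeries.C (a ^ (l + 1)) := by
    rw [← map_mul, div_mul_cancel₀ _ (pow_ne_zero _ ha)]
  rw [hz]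
  linear_combination PowerSeries.C (z / a ^ (l + 1)) * h
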